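/- All graphs are finite and simple. For a graph $G$, write $\delta(G)$ for its minimum degree and $\alpha(G)$ for its independence number. Let $g,f:V(G)\to\mathbb{Z}^{+}$ be functions with $g(x)\le f(x)$ for all $x\in V(G)$. A fractional $(g,f)$-factor of $G$ with indicator function $h:E(G)\to[0,1]$ is the spanning subgraph of $G$ with edge set $\{e\in E(G):h(e)\neq 0\}$, where $h$ satisfies $g(x)\le\sum_{e\in E(G),\,e\ni x}h(e)\le f(x)$ for every $x\in V(G)$. The graph $G$ is called a fractional $(g,f)$-covered graph if for every $e\in E(G)$ it has a fractional $(g,f)$-factor with an indicator function $h$ such that $h(e)=1$. Let $a,b,d$ be integers with $d\ge 0$, $a\ge 1$ and $b-d\ge\max\{a,2\}$. Let $G$ be a graph of order $p$ with $$p\ge\frac{(a+b-1)(a+b-2)+1}{a+d},$$ and let $g,f:V(G)\to\mathbb{Z}^{+}$ be functions such that $a\le g(x)\le f(x)-d\le b-d$ for all $x\in V(G)$. If $$\delta(G)\ge\frac{(b-d-1)p+a+b+1}{a+b-1}\qquad\text{and}\qquad \delta(G)>\frac{(b-d-2)p+2\alpha(G)+1}{a+b-2},$$ then $G$ is a fractional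 $(g,f)$-covered graph. -/

import Mathlib

/-- The weighted degree of `x`: the sum of `h e` over all edges `e` of `G` incident with `x`. -/
noncomputable def SimpleGraph.fracDegree {V : Type*} [Fintype V] [DecidableEq V]
    (G : SimpleGraph V) [DecidableRel G.Adj] (h : Sym2 V → ℝ) (x : V) : ℝ :=
  ∑ e ∈ G.incidenceFinset x, h e

/-- The spanning subgraph of `G` whose edges are the edges `e` of `G` with `h e ≠ 0`. -/
def SimpleGraph.fracSupport {V : Type*} (G : SimpleGraph V) (h : Sym2 V → ℝ) : SimpleGraph V :=
  SimpleGraph.fromEdgeSet {e | e ∈ G.edgeSet ∧ h e ≠ 0}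

/-- `F` is a fractional `(g, f)`-factor of `G` with indicator function `h`.
Only the values of `h` on the edges of `G` matter. -/
def SimpleGraph.IsFractionalFactor {V : Type*} [Fintype V] [DecidableEq V]
    (G : SimpleGraph V) [DecidableRel G.Adj] (g f : V → ℕ)
    (F : SimpleGraph V) (h : Sym2 V → ℝ) : Prop :=
  (∀ e ∈ G.edgeSet, 0 ≤ h e ∧ h e ≤ 1) ∧
  (∀ x : V, (g x : ℝ) ≤ G.fracDegree h x ∧ G.fracDegree h x ≤ (f x : ℝ)) ∧
  F = G.fracSupport h

/-- `G` is a fractional `(g, f)`-covered graph: every edge `e` of `G` is covered by a fractional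
`(g, f)`-factor whose indicator function takes the value `1` at `e`. -/
def SimpleGraph.IsFractionalCovered {V : Type*} [Fintype V] [DecidableEq V]
    (G : SimpleGraph V) [DecidableRel G.Adj] (g f : V → ℕ) : Prop :=
  ∀ e ∈ G.edgeSet, ∃ (F : SimpleGraph V) (h : Sym2 V → ℝ),
    G.IsFractionalFactor g f F h ∧ h e = 1

open Finset

/-! Suppose no suitable weighting takes the value 1 at the edge `e₀`. Minimise the sum of squared
defects over weightings with `h e₀ = 1`, and let `T` and `S` be the vertices of largest deficiency
and largest excess `M`. Optimality forces weight 1 on edges from `T` leaving `S` and weight 0 on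
edges other than `e₀` from `S` leaving `T`, so counting weight between `S` and `T` gives a barrier
(`exists_weighting_or_barrier`). With `A = a + d`, `B = b - d` and `r z` the number of neighbours of
`z` outside `S`, it reads `A|S| + ∑ z ∈ T, r z - B|T| ≤ 1`. Take `x ∈ T` with `r x` least, so that
`δ ≤ |S| + r x`. If `r x = 0`, `two_mul_card_le_indepNum_add_sum` contradicts the bound involving
`α`; otherwise `no_barrier_of_one_le` contradicts the other degree bound. -/

/-! ### Signed distance to an interval -/

/-- The signed distance from `r` to the interval `[lo, hi]`, positive below it. -/
noncomputable def intervalDefect (lo hi r : ℝ) : ℝ := max (lo - r) 0 - max (r - hi) 0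

/-- The point of the interval nearest to `r` is `r + intervalDefect lo hi r`; its distance to `r +
t` bounds the distance from `r + t` to the interval. -/
theorem intervalDefect_add_sq_le {lo hi : ℝ} (hle : lo ≤ hi) (r t : ℝ) :
    intervalDefect lo hi (r + t) ^ 2 ≤ (intervalDefect lo hi r - t) ^ 2 := by
  unfold intervalDefect
  rcases max_cases (lo - r) 0 with ⟨h1, _⟩ | ⟨h1, _⟩ <;>
  rcases max_cases (r - hi) 0 with ⟨h2, _⟩ | ⟨h2, _⟩ <;>
  rcases max_cases (lo - (r + t)) 0 with ⟨h3, _⟩ | ⟨h3, _⟩ <;>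
  rcases max_cases (r + t - hi) 0 with ⟨h4, _⟩ | ⟨h4, _⟩ <;>
  rw [h1, h2, h3, h4] <;> nlinarith

theorem eq_sub_intervalDefect_of_pos {lo hi r : ℝ} (hle : lo ≤ hi)
    (h : 0 < intervalDefect lo hi r) : r = lo - intervalDefect lo hi r := by
  unfold intervalDefect at *
  rcases max_cases (lo - r) 0 with ⟨h1, _⟩ | ⟨h1, _⟩ <;>
  rcases max_cases (r - hi) 0 with ⟨h2, _⟩ | ⟨h2, _⟩ <;> linarith

theorem eq_sub_intervalDefect_of_neg {lo hi r : ℝ} (hle : lo ≤ hi)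
    (h : intervalDefect lo hi r < 0) : r = hi - intervalDefect lo hi r := by
  unfold intervalDefect at *
  rcases max_cases (lo - r) 0 with ⟨h1, _⟩ | ⟨h1, _⟩ <;>
  rcases max_cases (r - hi) 0 with ⟨h2, _⟩ | ⟨h2, _⟩ <;> linarith

theorem mem_Icc_of_intervalDefect_eq_zero {lo hi r : ℝ} (hle : lo ≤ hi)
    (h : intervalDefect lo hi r = 0) : lo ≤ r ∧ r ≤ hi := by
  unfold intervalDefect at *
  rcases max_cases (lo - r) 0 with ⟨h1, _⟩ | ⟨h1, _⟩ <;>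
  rcases max_cases (r - hi) 0 with ⟨h2, _⟩ | ⟨h2, _⟩ <;> constructor <;> linarith

theorem continuous_intervalDefect (lo hi : ℝ) : Continuous (intervalDefect lo hi) := by
  unfold intervalDefect
  fun_prop

theorem sum_ite_mem_sym2_le_two {V : Type*} [DecidableEq V] (e₀ : Sym2 V) (S : Finset V) :
    ∑ x ∈ S, (if x ∈ e₀ then (1 : ℝ) else 0) ≤ 2 := by
  induction e₀ with | _ u v => ?_
  have : ∑ x ∈ S, (if x ∈ s(u, v) then (1 : ℝ) else 0) ≤
      ∑ x ∈ S, ((if x = u then (1 : ℝ) else 0) + if x = v then 1 else 0) := by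
    refine sum_le_sum fun x _ => ?_
    simp only [Sym2.mem_iff]
    by_cases h1 : x = u <;> by_cases h2 : x = v <;> simp [h1, h2]
    all_goals split_ifs <;> norm_num
  rw [sum_add_distrib, sum_ite_eq', sum_ite_eq'] at this
  split_ifs at this <;> linarith

/-! ### Optimal weightings and barriers -/

namespace SimpleGraph

variable {V : Type*} [Fintype V] [DecidableEq V] (G : SimpleGraph V) [DecidableRel G.Adj]

theorem fracDegree_eq_sum_neighborFinset (h : Sym2 V → ℝ) (x : V) :
    G.fracDegree h x = ∑ y ∈ G.neighborFinset x, h s(x, y) := by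
  unfold fracDegree
  symm
  refine Finset.sum_bij (fun y _ => s(x, y)) ?_ ?_ ?_ ?_
  · intro y hy
    simpa [mem_incidenceFinset, mk'_mem_incidenceSet_left_iff] using hy
  · intro y _ z _ hyz
    exact Sym2.congr_right.1 hyz
  · intro e he
    rw [mem_incidenceFinset] at he
    obtain ⟨y, rfl⟩ := Sym2.mem_iff_exists.1 he.2
    exact ⟨y, by simpa using he.1, rfl⟩
  · intros; rfl

theorem fracDegree_update (h : Sym2 V → ℝ) {e : Sym2 V} (he : e ∈ G.edgeSet) (t : ℝ) (x : V) :
    G.fracDegree (Function.update h e (h e + t)) x =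
      G.fracDegree h x + if x ∈ e then t else 0 := by
  unfold fracDegree
  have : ∀ e' ∈ G.incidenceFinset x, Function.update h e (h e + t) e' =
      h e' + if e' = e then t else 0 := by
    intro e' _
    by_cases h' : e' = e
    · subst h'; simp
    · simp [h']
  rw [sum_congr rfl this, sum_add_distrib, sum_ite_eq']
  simp [mem_incidenceFinset, incidenceSet, he]

/-- Among the weightings of the edges by numbers in `[0, 1]` that give `e₀` weight `1`, take one
whose degrees are as close as possible (in the square sense) to the intervals `[g x, f x]`. Then an
edge on which the total defect is positive (negative) has weight `1` (`0`). -/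
theorem exists_optimal_weighting (g f : V → ℝ) (hgf : ∀ x, g x ≤ f x) (e₀ : Sym2 V) :
    ∃ h : Sym2 V → ℝ, (∀ e, 0 ≤ h e ∧ h e ≤ 1) ∧ h e₀ = 1 ∧
      ∀ x y, G.Adj x y → s(x, y) ≠ e₀ →
        (0 < intervalDefect (g x) (f x) (G.fracDegree h x) +
            intervalDefect (g y) (f y) (G.fracDegree h y) → h s(x, y) = 1) ∧
        (intervalDefect (g x) (f x) (G.fracDegree h x) +
            intervalDefect (g y) (f y) (G.fracDegree h y) < 0 → h s(x, y) = 0) := by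
  -- The lower corner builds the constraint `h e₀ = 1` into a compact box.
  let K : Set (Sym2 V → ℝ) := Set.Icc (Pi.single e₀ 1) 1
  let Φ : (Sym2 V → ℝ) → ℝ := fun h => ∑ x, intervalDefect (g x) (f x) (G.fracDegree h x) ^ 2
  have hΦ : Continuous Φ := by
    refine continuous_finsetSum _ fun x _ => Continuous.pow ?_ 2
    refine (continuous_intervalDefect _ _).comp ?_
    unfold fracDegree
    fun_prop
  have hKne : K.Nonempty := by
    refine ⟨1, ⟨fun e => ?_, le_rfl⟩⟩
    by_cases he : e = e₀
    · subst he; simp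
    · simp [he]
  obtain ⟨h, hK, hmin⟩ := (isCompact_Icc : IsCompact K).exists_isMinOn hKne hΦ.continuousOn
  have h01 : ∀ e, 0 ≤ h e ∧ h e ≤ 1 := fun e => by
    refine ⟨le_trans ?_ (hK.1 e), hK.2 e⟩
    by_cases he : e = e₀
    · subst he; simp
    · simp [he]
  -- Shifting one edge by `t` raises the objective by at most `2t² - 2tc`, where `c` is the sum of
  -- the defects at its ends; minimality makes this nonnegative.
  have key : ∀ x y, G.Adj x y → s(x, y) ≠ e₀ → ∀ t, 0 ≤ h s(x, y) + t → h s(x, y) + t ≤ 1 →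
      t * (intervalDefect (g x) (f x) (G.fracDegree h x) +
        intervalDefect (g y) (f y) (G.fracDegree h y)) ≤ t ^ 2 := by
    intro x y hxy hne t ht0 ht1
    have hmem : Function.update h s(x, y) (h s(x, y) + t) ∈ K := by
      constructor
      · intro e
        by_cases he : e = s(x, y)
        · subst he; simpa [hne] using ht0
        · simpa [he] using hK.1 e
      · intro e
        by_cases he : e = s(x, y)
        · subst he; simpa using ht1
        · simpa [he] using hK.2 e
    have h1 : Φ h ≤ Φ (Function.update h s(x, y) (h s(x, y) + t)) := hmin hmem
    have h2 : Φ (Function.update h s(x, y) (h s(x, y) + t)) ≤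
        ∑ z, (intervalDefect (g z) (f z) (G.fracDegree h z) ^ 2 +
          ((if z = x then t ^ 2 - 2 * t * intervalDefect (g x) (f x) (G.fracDegree h x) else 0) +
          if z = y then t ^ 2 - 2 * t * intervalDefect (g y) (f y) (G.fracDegree h y) else 0)) := by
      refine sum_le_sum fun z _ => ?_
      rw [G.fracDegree_update h ((G.mem_edgeSet).2 hxy)]
      by_cases hzx : z = x
      · subst hzx
        have := intervalDefect_add_sq_le (hgf z) (G.fracDegree h z) t
        simp only [Sym2.mem_iff, true_or, if_true, hxy.ne, if_false]
        linarith
      · by_cases hzy : z = y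
        · subst hzy
          have := intervalDefect_add_sq_le (hgf z) (G.fracDegree h z) t
          simp only [Sym2.mem_iff, or_true, if_true, hzx, if_false]
          linarith
        · simp [hzx, hzy]
    rw [sum_add_distrib, sum_add_distrib, sum_ite_eq', sum_ite_eq'] at h2
    simp only [mem_univ, if_true] at h2
    have h3 : Φ h = ∑ z, intervalDefect (g z) (f z) (G.fracDegree h z) ^ 2 := rfl
    linarith
  refine ⟨h, h01, le_antisymm (h01 e₀).2 (by simpa using hK.1 e₀), fun x y hxy hne => ?_⟩
  specialize key x y hxy hne
  obtain ⟨hl, hu⟩ := h01 s(x, y)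
  generalize intervalDefect (g x) (f x) (G.fracDegree h x) +
    intervalDefect (g y) (f y) (G.fracDegree h y) = c at key ⊢
  constructor
  · intro hc
    by_contra hlt
    replace hlt : 0 < 1 - h s(x, y) := sub_pos.2 (lt_of_le_of_ne hu hlt)
    -- A shift `0 < t ≤ c / 2` violates `t * c ≤ t ^ 2`.
    have ht : 0 < min (1 - h s(x, y)) (c / 2) := lt_min hlt (by linarith)
    have := key _ (by linarith) (by linarith [min_le_left (1 - h s(x, y)) (c / 2)])
    nlinarith [min_le_right (1 - h s(x, y)) (c / 2)]
  · intro hc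
    by_contra hlt
    replace hlt : 0 < h s(x, y) := lt_of_le_of_ne hl (Ne.symm hlt)
    have ht : 0 < min (h s(x, y)) (-c / 2) := lt_min hlt (by linarith)
    have := key (-min (h s(x, y)) (-c / 2)) (by linarith [min_le_left (h s(x, y)) (-c / 2)])
      (by linarith)
    nlinarith [min_le_right (h s(x, y)) (-c / 2)]

theorem sum_neighborFinset_ite_eq_le (e₀ : Sym2 V) (x : V) (U : Finset V) :
    ∑ y ∈ G.neighborFinset x \ U, (if s(x, y) = e₀ then (1 : ℝ) else 0) ≤
      if x ∈ e₀ then 1 else 0 := by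
  by_cases hx : x ∈ e₀
  · obtain ⟨z, rfl⟩ := Sym2.mem_iff_exists.1 hx
    simp only [Sym2.congr_right, sum_ite_eq', hx, if_true]
    split_ifs <;> norm_num
  · rw [sum_eq_zero]
    · simp [hx]
    · intro y _
      rw [if_neg]
      rintro rfl
      simp at hx

/-- If no fractional `(g, f)`-factor takes the value `1` at `e₀`, then disjoint sets `S` and `T`
obstruct it. -/
theorem exists_weighting_or_barrier (g f : V → ℝ) (hgf : ∀ x, g x ≤ f x) (e₀ : Sym2 V) :
    (∃ h : Sym2 V → ℝ, (∀ e, 0 ≤ h e ∧ h e ≤ 1) ∧ h e₀ = 1 ∧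
      ∀ x, g x ≤ G.fracDegree h x ∧ G.fracDegree h x ≤ f x) ∨
    ∃ S T : Finset V, Disjoint S T ∧ (∀ x ∈ T, (#(G.neighborFinset x \ S) : ℝ) < g x) ∧
      ∑ x ∈ S, f x + ∑ x ∈ T, (#(G.neighborFinset x \ S) : ℝ) - ∑ x ∈ T, g x <
        ∑ x ∈ S, (if x ∈ e₀ then (1 : ℝ) else 0) := by
  obtain ⟨h, h01, h1, hopt⟩ := G.exists_optimal_weighting g f hgf e₀
  by_cases hall : ∀ x, intervalDefect (g x) (f x) (G.fracDegree h x) = 0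
  · exact .inl ⟨h, h01, h1, fun x => mem_Icc_of_intervalDefect_eq_zero (hgf x) (hall x)⟩
  right
  set l : V → ℝ := fun x => intervalDefect (g x) (f x) (G.fracDegree h x)
  push Not at hall
  obtain ⟨x₀, hx₀⟩ := hall
  obtain ⟨z, -, hz⟩ := exists_max_image univ (fun x => |l x|) ⟨x₀, mem_univ _⟩
  set M := |l z| with hM
  have hMpos : 0 < M := (abs_pos.2 hx₀).trans_le (hz x₀ (mem_univ _))
  have hlM : ∀ x, -M ≤ l x ∧ l x ≤ M := fun x => abs_le.1 (hz x (mem_univ _))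
  set S : Finset V := univ.filter fun x => l x = -M with hS
  set T : Finset V := univ.filter fun x => l x = M with hT
  have memS : ∀ x, x ∈ S ↔ l x = -M := by simp [hS]
  have memT : ∀ x, x ∈ T ↔ l x = M := by simp [hT]
  have hdisj : Disjoint S T := by
    rw [Finset.disjoint_left]
    intro x hx hx'
    rw [memS] at hx
    rw [memT] at hx'
    linarith
  have hTdeg : ∀ x ∈ T, G.fracDegree h x = g x - M := by
    intro x hx
    rw [memT] at hx
    have := eq_sub_intervalDefect_of_pos (r := G.fracDegree h x) (hgf x) (by
      change 0 < l x; linarith)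
    change _ = g x - l x at this
    rw [this, hx]
  have hSdeg : ∀ x ∈ S, G.fracDegree h x = f x + M := by
    intro x hx
    rw [memS] at hx
    have := eq_sub_intervalDefect_of_neg (r := G.fracDegree h x) (hgf x) (by
      change l x < 0; linarith)
    change _ = f x - l x at this
    rw [this, hx, sub_neg_eq_add]
  have hTsplit : ∀ x ∈ T, G.fracDegree h x = (#(G.neighborFinset x \ S) : ℝ) +
      ∑ y ∈ S, if G.Adj x y then h s(x, y) else 0 := by
    intro x hx
    rw [fracDegree_eq_sum_neighborFinset, ← sum_filter_not_add_sum_filter _ (· ∈ S),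
      ← sum_filter, card_eq_sum_ones, Nat.cast_sum, ← sdiff_eq_filter]
    congr 1
    · refine sum_congr rfl fun y hy => ?_
      rw [mem_sdiff, mem_neighborFinset, memS] at hy
      rw [memT] at hx
      by_cases he : s(x, y) = e₀
      · simp [he, h1]
      · have hy' : -M < l y := lt_of_le_of_ne (hlM y).1 (Ne.symm hy.2)
        simpa using (hopt x y hy.1 he).1 (by change 0 < l x + l y; linarith)
    · refine sum_congr ?_ fun _ _ => rfl
      ext y
      simp [and_comm]
  have hSsplit : ∀ x ∈ S, G.fracDegree h x ≤ (if x ∈ e₀ then 1 else 0) +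
      ∑ y ∈ T, if G.Adj x y then h s(x, y) else 0 := by
    intro x hx
    rw [fracDegree_eq_sum_neighborFinset, ← sum_filter_not_add_sum_filter _ (· ∈ T),
      ← sum_filter, ← sdiff_eq_filter]
    refine add_le_add ((sum_le_sum fun y hy => ?_).trans
      (G.sum_neighborFinset_ite_eq_le e₀ x T)) (le_of_eq ?_)
    · rw [mem_sdiff, mem_neighborFinset, memT] at hy
      rw [memS] at hx
      by_cases he : s(x, y) = e₀
      · simp [he, h1]
      · have hy' : l y < M := lt_of_le_of_ne (hlM y).2 hy.2
        rw [(hopt x y hy.1 he).2 (by change l x + l y < 0; linarith)]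
        simp [he]
    · refine sum_congr ?_ fun _ _ => rfl
      ext y
      simp [and_comm]
  refine ⟨S, T, hdisj, fun x hx => ?_, ?_⟩
  · have h2 := hTsplit x hx
    have h3 : 0 ≤ ∑ y ∈ S, if G.Adj x y then h s(x, y) else 0 :=
      sum_nonneg fun y _ => by split_ifs <;> simp [(h01 _).1]
    rw [hTdeg x hx] at h2
    linarith
  have hsumT := sum_congr (rfl : T = T) hTsplit
  rw [sum_congr rfl hTdeg, sum_sub_distrib, sum_add_distrib, sum_const, nsmul_eq_mul] at hsumT
  have hsumS := sum_le_sum hSsplit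
  rw [sum_congr rfl hSdeg, sum_add_distrib, sum_add_distrib, sum_const, nsmul_eq_mul] at hsumS
  have hcomm : ∑ x ∈ S, ∑ y ∈ T, (if G.Adj x y then h s(x, y) else 0) =
      ∑ x ∈ T, ∑ y ∈ S, if G.Adj x y then h s(x, y) else 0 := by
    rw [sum_comm]
    refine sum_congr rfl fun x _ => sum_congr rfl fun y _ => ?_
    simp only [Sym2.eq_swap (a := x), G.adj_comm x]
  -- This surplus makes the barrier inequality strict.
  have hne : 0 < (#S : ℝ) * M + #T * M := by
    have : z ∈ S ∨ z ∈ T := by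
      rw [memS, memT, hM]
      rcases abs_choice (l z) with h | h
      · exact .inr h.symm
      · exact .inl (by rw [h, neg_neg])
    rcases this with h | h
    · have hpos : 0 < (#S : ℝ) := Nat.cast_pos.2 (card_pos.2 ⟨z, h⟩)
      exact add_pos_of_pos_of_nonneg (mul_pos hpos hMpos) (mul_nonneg (Nat.cast_nonneg _) hMpos.le)
    · have hpos : 0 < (#T : ℝ) := Nat.cast_pos.2 (card_pos.2 ⟨z, h⟩)
      exact add_pos_of_nonneg_of_pos (mul_nonneg (Nat.cast_nonneg _) hMpos.le) (mul_pos hpos hMpos)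
  linarith

/-! ### Independence number and degree bounds -/

theorem sum_card_neighborFinset_inter_erase {U : Finset V} {x : V} (hx : x ∈ U) :
    ∑ z ∈ U, #(G.neighborFinset z ∩ U) =
      ∑ z ∈ U.erase x, #(G.neighborFinset z ∩ U.erase x) + 2 * #(G.neighborFinset x ∩ U) := by
  have h1 : ∀ z ∈ U.erase x, #(G.neighborFinset z ∩ U) =
      #(G.neighborFinset z ∩ U.erase x) + if G.Adj x z then 1 else 0 := by
    intro z _
    rw [inter_erase, card_erase_eq_ite]
    by_cases h : G.Adj x z
    · have hmem : x ∈ G.neighborFinset z ∩ U := by simp [hx, h.symm]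
      have := card_pos.2 ⟨x, hmem⟩
      simp only [hmem, h, if_true]
      omega
    · have hmem : x ∉ G.neighborFinset z ∩ U := by simp [hx, G.adj_comm z x, h]
      simp [hmem, h]
  have h2 : ∑ z ∈ U.erase x, (if G.Adj x z then 1 else 0) = #(G.neighborFinset x ∩ U) := by
    rw [← card_filter]
    congr 1
    ext z
    simp only [mem_filter, mem_erase, mem_inter, mem_neighborFinset]
    exact ⟨fun h => ⟨h.2, h.1.2⟩, fun h => ⟨⟨h.1.ne', h.2⟩, h.1⟩⟩
  rw [← add_sum_erase _ _ hx, sum_congr rfl h1, sum_add_distrib, h2]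
  omega

/-- Deleting one end of every edge inside `U` leaves an independent set. -/
theorem two_mul_card_le_indepNum_add_sum (U : Finset V) :
    2 * #U ≤ 2 * G.indepNum + ∑ z ∈ U, #(G.neighborFinset z ∩ U) := by
  induction hn : #U generalizing U with
  | zero => simp
  | succ n ih =>
    by_cases hU : G.IsIndepSet (U : Set V)
    · have := hU.card_le_indepNum
      omega
    · simp only [IsIndepSet, Set.Pairwise, mem_coe] at hU
      push Not at hU
      obtain ⟨x, hx, y, hy, -, hxy⟩ := hU
      -- Since `x` has a neighbour in `U`, erasing it lowers the degree sum by at least 2, which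
      -- pays for the lost vertex.
      have h1 := ih (U.erase x) (by rw [card_erase_of_mem hx, hn]; rfl)
      have h2 := G.sum_card_neighborFinset_inter_erase hx
      have h3 : 0 < #(G.neighborFinset x ∩ U) := card_pos.2 ⟨y, by simp [hxy, hy]⟩
      omega

theorem minDegree_le_card_add_card_sdiff (S : Finset V) (x : V) :
    G.minDegree ≤ #S + #(G.neighborFinset x \ S) := by
  have h1 := G.minDegree_le_degree x
  rw [← card_neighborFinset_eq_degree] at h1
  have h2 := le_card_sdiff S (G.neighborFinset x)
  omega

end SimpleGraph

/-! ### Arithmetic and conclusion -/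

/-- Here `k` stands for `r x - 1`. With `N = A + B - 1`, eliminating `s`, `t`, `δ` and `p` leaves `N
* k * (k - 1) + N - k ≤ 0`, although `k < N`. The gap in `hk` reflects integrality and gives `k * (k
- 1) ≥ 0`. -/
theorem no_barrier_of_one_le {A B k p s t δ : ℝ} (hA : 0 < A)
    (hk : k = 0 ∨ 1 ≤ k) (hkB : k + 2 ≤ B)
    (hbar : A * s - (B - 1 - k) * t ≤ 1) (hst : s + t ≤ p) (hδs : δ ≤ s + (k + 1))
    (hp : (A + B - 1) * (A + B - 2) + 1 ≤ A * p)
    (hδ : (B - 1) * p + A + B + 1 ≤ (A + B - 1) * δ) : False := by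
  have hk0 : 0 ≤ k := by rcases hk with h | h <;> linarith
  have h1 : (A + B - 1 - k) * (δ - 1 - k) ≤ (B - 1 - k) * p + 1 := by
    have e1 : (A + B - 1 - k) * (δ - 1 - k) ≤ (A + B - 1 - k) * s :=
      mul_le_mul_of_nonneg_left (by linarith) (by linarith)
    have e2 : (B - 1 - k) * (s + t) ≤ (B - 1 - k) * p :=
      mul_le_mul_of_nonneg_left hst (by linarith)
    linarith
  have h2 := mul_le_mul_of_nonneg_left h1 (show 0 ≤ A + B - 1 by linarith)
  have h3 := mul_le_mul_of_nonneg_left hδ (show 0 ≤ A + B - 1 - k by linarith)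
  have h4 := mul_le_mul_of_nonneg_left hp hk0
  have h5 : 0 ≤ (A + B - 1) * (k * (k - 1)) := by
    refine mul_nonneg (by linarith) ?_
    rcases hk with h | h
    · simp [h]
    · exact mul_nonneg hk0 (by linarith)
  linarith

theorem corollary3 {V : Type*} [Fintype V] [DecidableEq V]
    (G : SimpleGraph V) [DecidableRel G.Adj]
    (a b d : ℤ) (hd : 0 ≤ d) (ha : 1 ≤ a) (hbd : max a 2 ≤ b - d)
    (p : ℕ) (hcard : Fintype.card V = p)
    (hp : (((a : ℝ) + b - 1) * (a + b - 2) + 1) / (a + d) ≤ (p : ℝ))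
    (g f : V → ℕ)
    (hgpos : ∀ x, 0 < g x) (hfpos : ∀ x, 0 < f x)
    (hgf : ∀ x, a ≤ (g x : ℤ) ∧ (g x : ℤ) ≤ (f x : ℤ) - d ∧ (f x : ℤ) - d ≤ b - d)
    (hδ : (((b : ℝ) - d - 1) * p + a + b + 1) / (a + b - 1) ≤ (G.minDegree : ℝ))
    (hα : (((b : ℝ) - d - 2) * p + 2 * (G.indepNum : ℝ) + 1) / (a + b - 2) <
      (G.minDegree : ℝ)) :
    G.IsFractionalCovered g f := by
  intro e₀ he₀
  have hgf' : ∀ x, (g x : ℝ) ≤ f x := fun x => by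
    have := hgf x
    exact_mod_cast (by omega : (g x : ℤ) ≤ f x)
  rcases G.exists_weighting_or_barrier (fun x => g x) (fun x => f x) hgf' e₀ with
    ⟨h, h01, h1, hdeg⟩ | ⟨S, T, hdisj, hT, hbar⟩
  · exact ⟨_, h, ⟨fun e _ => h01 e, hdeg, rfl⟩, h1⟩
  exfalso
  -- If `T` is empty, `f ≥ 1` already outweighs the at most one unit that `e₀` contributes at each
  -- vertex of `S`.
  have hTne : T.Nonempty := by
    rw [nonempty_iff_ne_empty]
    rintro rfl
    have : ∑ x ∈ S, (if x ∈ e₀ then (1 : ℝ) else 0) ≤ ∑ x ∈ S, (f x : ℝ) := by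
      refine sum_le_sum fun x _ => ?_
      have : (1 : ℝ) ≤ f x := by exact_mod_cast hfpos x
      split_ifs <;> linarith
    simp only [sum_empty] at hbar
    linarith
  set r : V → ℕ := fun x => #(G.neighborFinset x \ S) with hr
  have hTr : ∀ x ∈ T, r x < g x := fun x hx => by exact_mod_cast hT x hx
  -- The edge `e₀` has two ends, so the left side is below 2; it is an integer.
  have hbarZ : ∑ x ∈ S, (f x : ℤ) + ∑ x ∈ T, (r x : ℤ) - ∑ x ∈ T, (g x : ℤ) ≤ 1 := by
    have := hbar.trans_le (sum_ite_mem_sym2_le_two e₀ S)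
    rw [← Int.lt_add_one_iff]
    exact_mod_cast this
  have hSf : (#S : ℤ) * (a + d) ≤ ∑ x ∈ S, (f x : ℤ) := by
    rw [← nsmul_eq_mul]
    exact card_nsmul_le_sum _ _ _ fun x _ => by have := hgf x; omega
  have hTg : ∑ x ∈ T, (g x : ℤ) ≤ (#T : ℤ) * (b - d) := by
    rw [← nsmul_eq_mul]
    exact sum_le_card_nsmul _ _ _ fun x _ => by have := hgf x; omega
  have hST : #S + #T ≤ p := by
    rw [← hcard, ← card_union_of_disjoint hdisj]
    exact card_le_univ _
  obtain ⟨x, hxT, hxmin⟩ := exists_min_image T r hTne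
  have hδx := G.minDegree_le_card_add_card_sdiff S x
  change _ ≤ _ + r x at hδx
  have hxB : (r x : ℤ) + 1 ≤ b - d := by
    have := hTr x hxT
    have := hgf x
    omega
  have hB2 : 2 ≤ b - d := le_trans (le_max_right _ _) hbd
  have hAR : (1 : ℝ) ≤ (a : ℝ) + d := by exact_mod_cast (by omega : 1 ≤ a + d)
  have hBR : (2 : ℝ) ≤ (b : ℝ) - d := by exact_mod_cast hB2
  have hSTR : (#S : ℝ) + #T ≤ p := by exact_mod_cast hST
  have hδxR : (G.minDegree : ℝ) ≤ #S + r x := by exact_mod_cast hδx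
  rw [div_le_iff₀ (by linarith)] at hp hδ
  rw [div_lt_iff₀ (by linarith)] at hα
  have hbarR : (#S : ℝ) * (a + d) + ∑ x ∈ T, (r x : ℝ) - #T * (b - d) ≤ 1 := by
    exact_mod_cast (by linarith : (#S : ℤ) * (a + d) + ∑ x ∈ T, (r x : ℤ) - #T * (b - d) ≤ 1)
  rcases Nat.eq_zero_or_pos (r x) with h0 | hpos
  -- Now `δ ≤ |S|`. Bounding `∑ r` below by `2|T| - 2α` lowers the coefficient of `|T|` from `B` to
  -- `B - 2`.
  · have hind : (2 : ℝ) * #T ≤ 2 * G.indepNum + ∑ z ∈ T, (r z : ℝ) := by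
      have h1 := G.two_mul_card_le_indepNum_add_sum T
      have h2 : ∑ z ∈ T, #(G.neighborFinset z ∩ T) ≤ ∑ z ∈ T, r z := by
        refine sum_le_sum fun z _ => card_le_card fun y hy => ?_
        rw [mem_inter] at hy
        exact mem_sdiff.2 ⟨hy.1, fun hyS => Finset.disjoint_left.1 hdisj hyS hy.2⟩
      exact_mod_cast h1.trans (Nat.add_le_add_left h2 _)
    rw [h0, Nat.cast_zero, add_zero] at hδxR
    have h1 := mul_le_mul_of_nonneg_left hSTR (show 0 ≤ (b : ℝ) - d - 2 by linarith)
    have h2 := mul_le_mul_of_nonneg_right hδxR (show 0 ≤ (a : ℝ) + b - 2 by linarith)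
    linarith
  · have hsum : (#T : ℝ) * r x ≤ ∑ z ∈ T, (r z : ℝ) := by
      rw [← nsmul_eq_mul]
      exact card_nsmul_le_sum _ _ _ fun z hz => by exact_mod_cast hxmin z hz
    have hk : (r x : ℝ) - 1 = 0 ∨ 1 ≤ (r x : ℝ) - 1 := by
      rcases (show r x = 1 ∨ 2 ≤ r x by omega) with h | h
      · left; rw [h]; norm_num
      · right
        have : (2 : ℝ) ≤ r x := by exact_mod_cast h
        linarith
    have hxBR : (r x : ℝ) + 1 ≤ b - d := by exact_mod_cast hxB
    exact no_barrier_of_one_le (A := a + d) (B := b - d) (k := r x - 1) (p := p) (s := #S)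
      (t := #T) (δ := G.minDegree) (by linarith) hk (by linarith) (by linarith) hSTR
      (by linarith) (by linarith) (by linarith)
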